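/- For an integer $N\ge 1$ let $\mathcal{L}(N)$ be the set of all complex polynomials $f(z)=c_0+c_1z+\dots+c_{N-1}z^{N-1}$ with every $c_j\in\{1,-1\}$, and let $D_N(z)=1+z+z^2+\dots+z^{N-1}$. Let $K\ge 1$ and $N_1,N_2,\dots,N_K\ge 1$ be integers. Then for any $f_k\in\mathcal{L}(N_k)$ and any real $t_k>0$, $1\le k\le K$, the functions $\theta\mapsto\log\left(\sum_{k=1}^K t_k|D_{N_k}(e^{i\theta})|^2\right)$ and $\theta\mapsto\log\left(\sum_{k=1}^K t_k|f_k(e^{i\theta})|^2\right)$ are integrable on $[0,2\pi]$, and $$\int_0^{2\pi}\log\left(\sum_{k=1}^K t_k|D_{N_k}(e^{i\theta})|^2\right)d\theta\;\le\;\int_0^{2\pi}\log\left(\sum_{k=1}^K t_k|f_k(e^{i\theta})|^2\right)d\theta .$$ -/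

import Mathlib

open Polynomial

/-- The Littlewood polynomials `c_0 + c_1 z + ⋯ + c_{N-1} z^{N-1}` with every `c_j ∈ {1, -1}`. -/
def LittlewoodPoly (N : ℕ) : Set ℂ[X] :=
  {f | ∃ c : ℕ → ℂ, (∀ j < N, c j = 1 ∨ c j = -1) ∧
    f = ∑ j ∈ Finset.range N, C (c j) * X ^ j}

/-- The polynomial `D_N(z) = 1 + z + ⋯ + z^{N-1}`. -/
noncomputable def dirichletPoly (N : ℕ) : ℂ[X] :=
  ∑ j ∈ Finset.range N, X ^ j

theorem dirichletPoly_mem (N : ℕ) : dirichletPoly N ∈ LittlewoodPoly N :=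
  ⟨fun _ => 1, fun _ _ => Or.inl rfl, by simp [dirichletPoly]⟩

/-! Add a term `ε > 0` to both sums, realised as `ε` times the square of the constant polynomial
`1`. Both integrands are then continuous, so each integral is the limit of Riemann sums over the
`m`-th roots of unity. Such a sum is `2π/m` times the log-determinant of a weighted sum of circulant
Gram matrices, diagonalised by the Fourier vectors (`det_gramMatrix`).

With `m = n + d` and `d` fixed, passing to the leading `n × n` block, a Toeplitz matrix, changes the
determinant by a factor bounded above and below independently of `n`, up to sizes needed for the
comparison (`det_bounds_of_posSemidef_sub`); after division by `m` this is negligible.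

The blocks compare exactly. By Cauchy–Binet each determinant is a nonnegative combination of squared
integer minors. For `D_N` the columns are indicators of intervals, so the minors are `0` or `±1`.
The coefficients `±1` of `f_k` have the same parity as those of `D_N`, so corresponding minors agree
mod 2: an odd one has square at least 1 (`det_gramBlock_le`). Finally `ε → 0` by dominated
convergence. -/

/-! ### Determinants of interval matrices -/

/-- A square matrix whose columns are indicators of intervals has determinant `0` or `±1`. -/
theorem abs_det_interval_le_one (n : ℕ) (a b : Fin n → ℕ) :
    |(Matrix.of fun i j : Fin n => if a j ≤ i ∧ (i : ℕ) < b j then (1 : ℤ) else 0).det| ≤ 1 := by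
  induction n with
  | zero => simp
  | succ n ih =>
    by_cases h : ∃ j, a j = 0 ∧ 0 < b j
    · obtain ⟨j₀, hj₀, hmin⟩ := Finset.exists_min_image
        (Finset.univ.filter fun j => a j = 0 ∧ 0 < b j) b (by
          obtain ⟨j, hj⟩ := h
          exact ⟨j, by simpa using hj⟩)
      simp only [Finset.mem_filter, Finset.mem_univ, true_and] at hj₀ hmin
      -- Subtract column `j₀` from every other column meeting row 0. Since `b j₀` is minimal the
      -- differences are again intervals, and row 0 keeps a single nonzero entry.
      let a' : Fin (n + 1) → ℕ := fun j => if j ≠ j₀ ∧ a j = 0 ∧ 0 < b j then b j₀ else a j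
      have hdet : (Matrix.of fun i j : Fin (n + 1) =>
            if a j ≤ i ∧ (i : ℕ) < b j then (1 : ℤ) else 0).det
          = (Matrix.of fun i j : Fin (n + 1) =>
            if a' j ≤ i ∧ (i : ℕ) < b j then (1 : ℤ) else 0).det := by
        rw [← Matrix.det_transpose, ← Matrix.det_transpose (Matrix.of fun i j : Fin (n + 1) =>
            if a' j ≤ i ∧ (i : ℕ) < b j then (1 : ℤ) else 0)]
        refine Matrix.det_eq_of_forall_row_eq_smul_add_const
          (fun j => if j ≠ j₀ ∧ a j = 0 ∧ 0 < b j then (1 : ℤ) else 0) j₀ (by simp) ?_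
        intro j i
        by_cases hj : j ≠ j₀ ∧ a j = 0 ∧ 0 < b j
        · have := hmin j hj.2
          simp only [Matrix.transpose_apply, Matrix.of_apply, a', ne_eq, not_true_eq_false,
            false_and, if_false, hj.2.1, hj₀.1]
          split_ifs <;> first | rfl | omega
        · simp only [Matrix.transpose_apply, Matrix.of_apply, a', if_neg hj, zero_mul, add_zero]
      rw [hdet, Matrix.det_succ_row_zero, Finset.sum_eq_single j₀]
      · have h1 : a' j₀ = 0 := by simp [a', hj₀.1]
        rw [abs_mul, abs_mul]
        simp only [abs_pow, abs_neg, abs_one, one_pow, one_mul, Matrix.of_apply, h1]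
        rw [if_pos ⟨by simp, by simpa using hj₀.2⟩, abs_one, one_mul]
        convert! ih (fun j => a' (j₀.succAbove j) - 1) (fun j => b (j₀.succAbove j) - 1) using 4
        ext i j
        simp only [Matrix.submatrix_apply, Matrix.of_apply, Fin.val_succ]
        congr 1
        apply propext
        omega
      · intro j _ hj
        have : ¬ (a' j ≤ ((0 : Fin (n + 1)) : ℕ) ∧ ((0 : Fin (n + 1)) : ℕ) < b j) := by
          simp only [a', Fin.val_zero]
          split_ifs <;> grind
        simp only [Matrix.of_apply, if_neg this]
        simp
      · simp
    · rw [Matrix.det_eq_zero_of_row_eq_zero 0]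
      · simp
      · intro j
        have : ¬ (a j ≤ ((0 : Fin (n + 1)) : ℕ) ∧ ((0 : Fin (n + 1)) : ℕ) < b j) := by
          rw [Fin.val_zero]
          grind
        exact if_neg this

/-! ### Cauchy–Binet -/

/-- A form of the Cauchy–Binet formula: the sum runs over all choices of columns, so that each
set of columns is counted `n!` times. -/
theorem factorial_mul_det_mul_diagonal_mul_transpose {n ι R : Type*} [Fintype n] [DecidableEq n]
    [Fintype ι] [DecidableEq ι] [CommRing R] (A : Matrix n ι R) (w : ι → R) :
    ((Fintype.card n).factorial : R) * (A * Matrix.diagonal w * A.transpose).det =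
      ∑ p : n → ι, (∏ i, w (p i)) * (A.submatrix id p).det ^ 2 := by
  have h1 : (A * Matrix.diagonal w * A.transpose).det =
      ∑ p : n → ι, (∏ i, w (p i)) * ((∏ i, A i (p i)) * (A.submatrix id p).det) := by
    rw [Matrix.det_apply']
    have h0 (i j : n) : (A * Matrix.diagonal w * A.transpose) i j = ∑ x, A i x * w x * A j x := by
      rw [Matrix.mul_apply]
      simp only [Matrix.mul_diagonal, Matrix.transpose_apply]
    simp only [h0, Finset.prod_univ_sum, Fintype.piFinset_univ, Finset.mul_sum]
    rw [Finset.sum_comm]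
    refine Finset.sum_congr rfl fun p _ => ?_
    rw [Matrix.det_apply', Finset.mul_sum, Finset.mul_sum]
    refine Finset.sum_congr rfl fun σ _ => ?_
    simp only [Finset.prod_mul_distrib, Matrix.submatrix_apply, id]
    ring
  -- Relabelling `p` by `τ` costs a sign in the minor; summing over all `τ` turns the remaining
  -- product into a second copy of the minor.
  have h2 (τ : Equiv.Perm n) : (A * Matrix.diagonal w * A.transpose).det =
      ∑ p : n → ι, (∏ i, w (p i)) *
        (((Equiv.Perm.sign τ : ℤ) : R) * (∏ i, A i (p (τ i))) * (A.submatrix id p).det) := by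
    rw [h1, ← Equiv.sum_comp (Equiv.arrowCongr τ.symm (Equiv.refl ι))]
    refine Finset.sum_congr rfl fun p _ => ?_
    have e : A.submatrix id (fun i => p (τ i)) = (A.submatrix id p).submatrix id τ := rfl
    have e' : Equiv.arrowCongr τ.symm (Equiv.refl ι) p = fun i => p (τ i) := rfl
    rw [e', e, Matrix.det_permute', Equiv.prod_comp τ (fun i => w (p i))]
    ring
  have h3 : ∑ _τ : Equiv.Perm n, (A * Matrix.diagonal w * A.transpose).det =
      ((Fintype.card n).factorial : R) * (A * Matrix.diagonal w * A.transpose).det := by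
    simp [Fintype.card_perm]
  rw [← h3, Finset.sum_congr rfl fun τ _ => h2 τ, Finset.sum_comm]
  refine Finset.sum_congr rfl fun p _ => ?_
  rw [← Finset.mul_sum, ← Finset.sum_mul, sq]
  congr 2
  rw [← Matrix.det_transpose (A.submatrix id p), Matrix.det_apply']
  rfl

/-! ### Determinant bounds for positive matrices -/

theorem pow_card_le_det_of_posSemidef_sub {n : Type*} [Fintype n] [DecidableEq n]
    {S : Matrix n n ℝ} {ε : ℝ} (hε : 0 ≤ ε) (h : (S - ε • (1 : Matrix n n ℝ)).PosSemidef) :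
    ε ^ Fintype.card n ≤ S.det := by
  have hS : S.IsHermitian := by
    have := h.1.add (Matrix.isHermitian_one.smul (k := ε) (by simp [IsSelfAdjoint]))
    simpa using this
  rw [hS.det_eq_prod_eigenvalues]
  have key (i) : ε ≤ hS.eigenvalues i := by
    have h1 := h.dotProduct_mulVec_nonneg (hS.eigenvectorBasis i)
    have h2 := hS.eigenvalues_eq i
    have h3 : star (hS.eigenvectorBasis i : n → ℝ) ⬝ᵥ (hS.eigenvectorBasis i : n → ℝ) = 1 := by
      have := hS.eigenvectorBasis.orthonormal.1 i
      rw [EuclideanSpace.norm_eq, Real.sqrt_eq_one] at this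
      simp only [dotProduct, Pi.star_apply, star_trivial]
      rw [← this]
      exact Finset.sum_congr rfl fun j _ => by simp [sq]
    rw [Matrix.sub_mulVec, dotProduct_sub, Matrix.smul_mulVec, Matrix.one_mulVec, dotProduct_smul,
      h3] at h1
    simp only [RCLike.re_to_real] at h2
    rw [h2]
    simpa using h1
  calc ε ^ Fintype.card n = ∏ _i : n, ε := by simp
    _ ≤ _ := Finset.prod_le_prod (fun _ _ => hε) fun i _ => key i

theorem Matrix.PosSemidef.det_le_trace_pow {n : Type*} [Fintype n] [DecidableEq n]
    {S : Matrix n n ℝ} (h : S.PosSemidef) : S.det ≤ S.trace ^ Fintype.card n := by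
  have hS := h.1
  rw [hS.det_eq_prod_eigenvalues, hS.trace_eq_sum_eigenvalues]
  calc _ ≤ ∏ _i : n, ∑ j, hS.eigenvalues j := Finset.prod_le_prod
        (fun i _ => h.eigenvalues_nonneg i)
        fun i _ => Finset.single_le_sum (f := hS.eigenvalues)
          (fun j _ => h.eigenvalues_nonneg j) (Finset.mem_univ i)
    _ = _ := by simp

/-- If `M ≥ ε > 0`, then passing from a principal block to `M` multiplies the determinant by a
factor bounded below by a power of `ε` and above by a power of the trace of the other block. -/
theorem det_bounds_of_posSemidef_sub {α β : Type*} [Fintype α] [DecidableEq α] [Fintype β]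
    [DecidableEq β] {M : Matrix (α ⊕ β) (α ⊕ β) ℝ} {ε : ℝ} (hε : 0 < ε)
    (h : (M - ε • (1 : Matrix (α ⊕ β) (α ⊕ β) ℝ)).PosSemidef) :
    0 < M.toBlocks₁₁.det ∧ M.toBlocks₁₁.det * ε ^ Fintype.card β ≤ M.det ∧
      M.det ≤ M.toBlocks₁₁.det * M.toBlocks₂₂.trace ^ Fintype.card β := by
  have hM : M.PosDef := by
    have := Matrix.PosDef.posSemidef_add h (Matrix.PosDef.one.smul hε)
    simpa using this
  set A := M.toBlocks₁₁ with hA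
  set B := M.toBlocks₁₂ with hB
  set D := M.toBlocks₂₂ with hD
  have hC : M.toBlocks₂₁ = B.conjTranspose := by
    ext i j
    have := hM.1.apply (Sum.inl j) (Sum.inr i)
    simp [hB, Matrix.toBlocks₂₁, Matrix.toBlocks₁₂, ← this]
  have hMb : M = Matrix.fromBlocks A B B.conjTranspose D := by
    rw [← hC, Matrix.fromBlocks_toBlocks]
  have hAd : A.PosDef := by
    have := hM.submatrix (e := Sum.inl) Sum.inl_injective
    exact this
  have : Invertible A := hAd.isUnit.invertible
  have hS : (D - B.conjTranspose * A⁻¹ * B - ε • (1 : Matrix β β ℝ)).PosSemidef := by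
    -- Lowering only the second diagonal block by `ε` keeps positivity, and the Schur complement of
    -- the result is the original one minus `ε`.
    have h1 : (Matrix.fromBlocks A B B.conjTranspose (D - ε • (1 : Matrix β β ℝ))).PosSemidef := by
      have h2 : (Matrix.fromBlocks (ε • (1 : Matrix α α ℝ)) 0 0 (0 : Matrix β β ℝ)).PosSemidef := by
        rw [show Matrix.fromBlocks (ε • (1 : Matrix α α ℝ)) 0 0 (0 : Matrix β β ℝ) =
          Matrix.diagonal (Sum.elim (fun _ => ε) (fun _ => 0)) by
            rw [← Matrix.diagonal_one, ← Matrix.diagonal_smul, ← Matrix.diagonal_zero,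
              Matrix.fromBlocks_diagonal]
            congr 1; ext i; cases i <;> simp]
        refine Matrix.PosSemidef.diagonal ?_
        intro i; cases i <;> simp [hε.le]
      have h3 := h.add h2
      convert! h3 using 1
      rw [hMb, ← Matrix.fromBlocks_one, Matrix.fromBlocks_smul,
        sub_eq_add_neg (Matrix.fromBlocks A _ _ _), Matrix.fromBlocks_neg, Matrix.fromBlocks_add,
        Matrix.fromBlocks_add]
      simp [sub_eq_add_neg]
    rw [Matrix.PosDef.fromBlocks₁₁ _ _ hAd] at h1
    rwa [sub_right_comm] at h1
  have hSp : (D - B.conjTranspose * A⁻¹ * B).PosSemidef := by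
    have := hS.add (Matrix.PosSemidef.one.smul hε.le)
    simpa using this
  have hdet : M.det = A.det * (D - B.conjTranspose * A⁻¹ * B).det := by
    conv_lhs => rw [hMb]
    rw [Matrix.det_fromBlocks₁₁, Matrix.invOf_eq_nonsing_inv]
  have htr : (D - B.conjTranspose * A⁻¹ * B).trace ≤ D.trace := by
    rw [Matrix.trace_sub]
    have := (hAd.inv.posSemidef.conjTranspose_mul_mul_same B).trace_nonneg
    linarith
  have hA0 := hAd.det_pos
  refine ⟨hA0, ?_, ?_⟩
  · rw [hdet]
    exact mul_le_mul_of_nonneg_left (pow_card_le_det_of_posSemidef_sub hε.le hS) hA0.le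
  · rw [hdet]
    refine mul_le_mul_of_nonneg_left (hSp.det_le_trace_pow.trans ?_) hA0.le
    exact pow_le_pow_left₀ hSp.trace_nonneg htr _

/-! ### Circulant matrices and their eigenvalues -/

/-- The circulant matrix with first row `c 0, c 1, …, c (m - 1)`. -/
def shiftMatrix {R : Type*} (m : ℕ) (c : ℕ → R) : Matrix (Fin m) (Fin m) R :=
  Matrix.of fun i j => c (j - i : Fin m)

theorem pow_val_add {m : ℕ} {z : ℂ} (hz : z ^ m = 1) (a b : Fin m) :
    z ^ ((a + b : Fin m) : ℕ) = z ^ (a : ℕ) * z ^ (b : ℕ) := by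
  rw [Fin.val_add, ← pow_add, ← Nat.mod_add_div ((a : ℕ) + b) m, pow_add, pow_mul, hz]
  simp

theorem shiftMatrix_mulVec_pow {m : ℕ} [NeZero m] (c : ℕ → ℂ) {z : ℂ} (hz : z ^ m = 1) :
    (shiftMatrix m c).mulVec (fun j => z ^ (j : ℕ)) =
      (∑ l ∈ Finset.range m, c l * z ^ l) • fun j : Fin m => z ^ (j : ℕ) := by
  ext i
  simp only [Matrix.mulVec, dotProduct, shiftMatrix, Matrix.of_apply, Pi.smul_apply, smul_eq_mul]
  rw [← Equiv.sum_comp (Equiv.addRight i), Finset.sum_range, Finset.sum_mul]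
  refine Finset.sum_congr rfl fun j _ => ?_
  simp only [Equiv.coe_addRight, add_sub_cancel_right, pow_val_add hz]
  ring

theorem shiftMatrix_transpose_mulVec_pow {m : ℕ} [NeZero m] (c : ℕ → ℂ) {z : ℂ}
    (hz : z ^ m = 1) :
    (shiftMatrix m c).transpose.mulVec (fun j => z ^ (j : ℕ)) =
      (∑ l ∈ Finset.range m, c l * z⁻¹ ^ l) • fun j : Fin m => z ^ (j : ℕ) := by
  have hz0 : z ≠ 0 := by
    rintro rfl
    simp [zero_pow (NeZero.ne m)] at hz
  ext i
  simp only [Matrix.mulVec, dotProduct, shiftMatrix, Matrix.of_apply, Pi.smul_apply, smul_eq_mul,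
    Matrix.transpose_apply]
  rw [← Equiv.sum_comp (Equiv.subLeft i), Finset.sum_range, Finset.sum_mul]
  refine Finset.sum_congr rfl fun j _ => ?_
  have h := pow_val_add hz (i - j) j
  rw [sub_add_cancel] at h
  simp only [Equiv.subLeft_apply, sub_sub_cancel, h, inv_pow]
  field_simp

/-- The trigonometric polynomial `∑_{l < N} c_l e^{ilθ}`. -/
noncomputable def trigSum (N : ℕ) (c : ℕ → ℤ) (θ : ℝ) : ℂ :=
  ∑ l ∈ Finset.range N, (c l : ℂ) * Complex.exp (Complex.I * (θ : ℂ)) ^ l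

/-- The weighted sum of squares `∑_k t_k |∑_l c_{k,l} e^{ilθ}|²`. -/
noncomputable def sqSum {κ : Type*} [Fintype κ] (t : κ → ℝ) (N : κ → ℕ) (c : κ → ℕ → ℤ)
    (θ : ℝ) : ℝ :=
  ∑ k, t k * ‖trigSum (N k) (c k) θ‖ ^ 2

/-- The weighted sum of Gram matrices of the circulant matrices of the sequences `c k`. -/
noncomputable def gramMatrix {κ : Type*} [Fintype κ] (t : κ → ℝ) (c : κ → ℕ → ℤ) (m : ℕ) :
    Matrix (Fin m) (Fin m) ℝ :=
  ∑ k, t k • (shiftMatrix m (fun l => (c k l : ℝ)) *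
    (shiftMatrix m (fun l => (c k l : ℝ))).transpose)

theorem trigSum_of_le {N m : ℕ} {c : ℕ → ℤ} (hc : ∀ l, N ≤ l → c l = 0) (h : N ≤ m) (θ : ℝ) :
    trigSum m c θ = trigSum N c θ := by
  refine (Finset.sum_subset (by simpa using h) ?_).symm
  intro l _ hl
  simp [hc l (by simpa using hl)]

theorem conj_trigSum (N : ℕ) (c : ℕ → ℤ) (θ : ℝ) :
    (starRingEnd ℂ) (trigSum N c θ) =
      ∑ l ∈ Finset.range N, (c l : ℂ) * (Complex.exp (Complex.I * (θ : ℂ)))⁻¹ ^ l := by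
  simp [trigSum, map_sum, ← Complex.exp_conj, ← Complex.exp_neg]

theorem gramMatrix_mulVec_pow {κ : Type*} [Fintype κ] (t : κ → ℝ) {N : κ → ℕ} {c : κ → ℕ → ℤ}
    (hc : ∀ k l, N k ≤ l → c k l = 0) {m : ℕ} [NeZero m] (hm : ∀ k, N k ≤ m) {θ : ℝ}
    (hθ : Complex.exp (Complex.I * (θ : ℂ)) ^ m = 1) :
    ((gramMatrix t c m).map Complex.ofReal).mulVec
        (fun j => Complex.exp (Complex.I * (θ : ℂ)) ^ (j : ℕ)) =
      (sqSum t N c θ : ℂ) • fun j : Fin m => Complex.exp (Complex.I * (θ : ℂ)) ^ (j : ℕ) := by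
  have h1 : (gramMatrix t c m).map Complex.ofReal = ∑ k, (t k : ℂ) •
      (shiftMatrix m (fun l => (c k l : ℂ)) *
        (shiftMatrix m (fun l => (c k l : ℂ))).transpose) := by
    ext i j
    simp [gramMatrix, Matrix.sum_apply, Matrix.mul_apply, shiftMatrix]
  rw [h1, Matrix.sum_mulVec, sqSum, Complex.ofReal_sum, Finset.sum_smul]
  refine Finset.sum_congr rfl fun k _ => ?_
  rw [Matrix.smul_mulVec, ← Matrix.mulVec_mulVec, shiftMatrix_transpose_mulVec_pow _ hθ,
    Matrix.mulVec_smul, shiftMatrix_mulVec_pow _ hθ, smul_smul, smul_smul, ← conj_trigSum]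
  have e : ∑ l ∈ Finset.range m, (c k l : ℂ) * Complex.exp (Complex.I * (θ : ℂ)) ^ l =
    trigSum m (c k) θ := rfl
  rw [e, mul_assoc, trigSum_of_le (hc k) (hm k), mul_comm (starRingEnd ℂ _), Complex.mul_conj,
    Complex.normSq_eq_norm_sq]
  push_cast
  rfl

/-- The Fourier vectors, as columns of an invertible Vandermonde matrix, diagonalise all the
circulants and their transposes at once. On the unit circle the two eigenvalues are conjugate, which
produces the squared modulus. -/
theorem det_gramMatrix {κ : Type*} [Fintype κ] (t : κ → ℝ) {N : κ → ℕ} {c : κ → ℕ → ℤ}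
    (hc : ∀ k l, N k ≤ l → c k l = 0) {m : ℕ} [NeZero m] (hm : ∀ k, N k ≤ m) :
    (gramMatrix t c m).det = ∏ l : Fin m, sqSum t N c (2 * Real.pi * (l : ℕ) / m) := by
  have hm0 : m ≠ 0 := NeZero.ne m
  have hmC : (m : ℂ) ≠ 0 := by exact_mod_cast hm0
  have hprim := Complex.isPrimitiveRoot_exp m hm0
  set ζ := Complex.exp (2 * Real.pi * Complex.I / m) with hζ
  have hz (l : Fin m) :
      Complex.exp (Complex.I * ((2 * Real.pi * (l : ℕ) / m : ℝ) : ℂ)) = ζ ^ (l : ℕ) := by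
    rw [hζ, ← Complex.exp_nat_mul]
    congr 1
    push_cast
    ring
  set z : Fin m → ℂ := fun l => ζ ^ (l : ℕ)
  have hinj : Function.Injective z := fun a b h => Fin.ext (hprim.pow_inj a.2 b.2 h)
  have hV : (Matrix.vandermonde z).transpose.det ≠ 0 := by
    rw [Matrix.det_transpose]
    exact Matrix.det_vandermonde_ne_zero_iff.2 hinj
  have hmul : (gramMatrix t c m).map Complex.ofReal * (Matrix.vandermonde z).transpose =
      (Matrix.vandermonde z).transpose * Matrix.diagonal
        (fun l : Fin m => (sqSum t N c (2 * Real.pi * (l : ℕ) / m) : ℂ)) := by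
    ext i l
    have hzm : Complex.exp (Complex.I * ((2 * Real.pi * (l : ℕ) / m : ℝ) : ℂ)) ^ m = 1 := by
      rw [hz, ← pow_mul, mul_comm, pow_mul, hprim.pow_eq_one, one_pow]
    have h := congrFun (gramMatrix_mulVec_pow t hc hm hzm) i
    rw [hz] at h
    rw [Matrix.mul_diagonal, mul_comm]
    exact h
  have hdet := congrArg Matrix.det hmul
  rw [Matrix.det_mul, Matrix.det_mul, mul_comm, Matrix.det_diagonal] at hdet
  have h2 := mul_left_cancel₀ hV hdet
  have h3 : ((gramMatrix t c m).map Complex.ofReal).det = ((gramMatrix t c m).det : ℂ) :=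
    (RingHom.map_det Complex.ofRealHom _).symm
  rw [h3] at h2
  exact_mod_cast h2

/-! ### Toeplitz blocks and parity of minors -/

/-- The principal block of the Gram matrix on the first `n` indices. -/
noncomputable def gramBlock {κ : Type*} [Fintype κ] (t : κ → ℝ) (c : κ → ℕ → ℤ) (n d : ℕ) :
    Matrix (Fin n) (Fin n) ℝ :=
  ((gramMatrix t c (n + d)).submatrix finSumFinEquiv finSumFinEquiv).toBlocks₁₁

/-- The first `n` rows of all the circulant matrices, placed next to each other. -/
def rowMatrix {κ : Type*} (c : κ → ℕ → ℤ) (n d : ℕ) : Matrix (Fin n) (κ × Fin (n + d)) ℤ :=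
  Matrix.of fun i x => c x.1 (x.2 - Fin.castAdd d i : Fin (n + d))

theorem factorial_mul_det_gramBlock {κ : Type*} [Fintype κ] [DecidableEq κ] (t : κ → ℝ)
    (c : κ → ℕ → ℤ) (n d : ℕ) :
    (n.factorial : ℝ) * (gramBlock t c n d).det = ∑ p : Fin n → κ × Fin (n + d),
      (∏ i, t (p i).1) * (((rowMatrix c n d).submatrix id p).det : ℝ) ^ 2 := by
  have h : gramBlock t c n d = (rowMatrix c n d).map (Int.cast : ℤ → ℝ) *
      Matrix.diagonal (fun x : κ × Fin (n + d) => t x.1) *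
      ((rowMatrix c n d).map (Int.cast : ℤ → ℝ)).transpose := by
    ext i j
    rw [Matrix.mul_apply]
    simp_rw [Matrix.mul_diagonal]
    simp only [Fintype.sum_prod_type, Matrix.transpose_apply, Matrix.map_apply,
      gramBlock, gramMatrix, Matrix.toBlocks₁₁, Matrix.of_apply, Matrix.submatrix_apply,
      Matrix.sum_apply, Matrix.smul_apply, Matrix.mul_apply, smul_eq_mul, Finset.mul_sum,
      finSumFinEquiv_apply_left, shiftMatrix, rowMatrix]
    refine Finset.sum_congr rfl fun k _ => Finset.sum_congr rfl fun x _ => ?_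
    ring
  have h2 := factorial_mul_det_mul_diagonal_mul_transpose
    ((rowMatrix c n d).map (Int.cast : ℤ → ℝ)) (fun x : κ × Fin (n + d) => t x.1)
  rw [Fintype.card_fin] at h2
  rw [h, h2]
  refine Finset.sum_congr rfl fun p _ => ?_
  congr 2
  exact (RingHom.map_det (Int.castRingHom ℝ) _).symm

/-- The coefficient sequence of `1 + z + ⋯ + z^{N-1}`. -/
def onesSeq (N : ℕ) (l : ℕ) : ℤ := if l < N then 1 else 0

/-- The margin `d ≥ N k` prevents wrap-around inside the first `n` rows, so each column is the
indicator of an honest, not cyclic, interval. Truncated subtraction clips its lower end at 0. -/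
theorem abs_det_rowMatrix_onesSeq_le_one {κ : Type*} {N : κ → ℕ} {n d : ℕ}
    (hd : ∀ k, N k ≤ d) (p : Fin n → κ × Fin (n + d)) :
    |((rowMatrix (fun k => onesSeq (N k)) n d).submatrix id p).det| ≤ 1 := by
  convert! abs_det_interval_le_one n (fun j => (p j).2 + 1 - N (p j).1) (fun j => (p j).2 + 1)
    using 4
  ext i j
  simp only [Matrix.submatrix_apply, id, rowMatrix, Matrix.of_apply, onesSeq]
  congr 1
  apply propext
  have h1 := hd (p j).1
  have h2 := i.2
  have h3 := (p j).2.2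
  generalize (p j).2 = x at *
  rw [Fin.val_sub, Fin.val_castAdd]
  by_cases hx : (i : ℕ) ≤ x
  · rw [show n + d - (i : ℕ) + x = (x - i) + (n + d) by omega, Nat.add_mod_right,
      Nat.mod_eq_of_lt (by omega)]
    omega
  · rw [Nat.mod_eq_of_lt (by omega)]
    omega

theorem sq_le_sq_of_cast_zmod_two_eq {a b : ℤ} (ha : |a| ≤ 1)
    (h : (a : ZMod 2) = (b : ZMod 2)) : a ^ 2 ≤ b ^ 2 := by
  rw [ZMod.intCast_eq_intCast_iff_dvd_sub] at h
  rw [sq_le_sq]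
  by_cases hb : b = 0
  · subst hb
    have : a = 0 := by
      rw [abs_le] at ha
      omega
    simp [this]
  · exact ha.trans (Int.one_le_abs hb)

theorem det_gramBlock_le {κ : Type*} [Fintype κ] {t : κ → ℝ} (ht : ∀ k, 0 ≤ t k) {N : κ → ℕ}
    {c : κ → ℕ → ℤ} (hc : ∀ k l, (onesSeq (N k) l : ZMod 2) = c k l) {n d : ℕ}
    (hd : ∀ k, N k ≤ d) :
    (gramBlock t (fun k => onesSeq (N k)) n d).det ≤ (gramBlock t c n d).det := by
  classical
  have hn : (0 : ℝ) < n.factorial := by exact_mod_cast n.factorial_pos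
  refine le_of_mul_le_mul_left ?_ hn
  rw [factorial_mul_det_gramBlock, factorial_mul_det_gramBlock]
  refine Finset.sum_le_sum fun p _ =>
    mul_le_mul_of_nonneg_left ?_ (Finset.prod_nonneg fun i _ => ht _)
  have h := sq_le_sq_of_cast_zmod_two_eq (abs_det_rowMatrix_onesSeq_le_one hd p)
    (b := ((rowMatrix c n d).submatrix id p).det) (by
      have e (M : Matrix (Fin n) (Fin n) ℤ) :
          ((M.det : ℤ) : ZMod 2) = (M.map (Int.cast : ℤ → ZMod 2)).det :=
        RingHom.map_det (Int.castRingHom (ZMod 2)) _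
      rw [e, e]
      congr 1
      ext i j
      exact hc _ _)
  exact_mod_cast h

/-! ### From Toeplitz blocks back to circulants -/

/-- The term `k₀` contributes exactly `t k₀` times the identity; the others are Gram matrices. -/
theorem posSemidef_gramMatrix_sub {κ : Type*} [Fintype κ] {t : κ → ℝ} (ht : ∀ k, 0 ≤ t k)
    {c : κ → ℕ → ℤ} {k₀ : κ} (hk₀ : c k₀ = onesSeq 1) (m : ℕ) [NeZero m] :
    (gramMatrix t c m - t k₀ • (1 : Matrix (Fin m) (Fin m) ℝ)).PosSemidef := by
  classical
  have h1 : shiftMatrix m (fun l => (c k₀ l : ℝ)) = 1 := by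
    ext i j
    have : j - i = 0 ↔ i = j := by rw [sub_eq_zero, eq_comm]
    simp [shiftMatrix, hk₀, onesSeq, Matrix.one_apply, this]
  rw [gramMatrix, ← Finset.add_sum_erase _ _ (Finset.mem_univ k₀), h1, Matrix.transpose_one,
    Matrix.mul_one, add_sub_cancel_left]
  refine Matrix.posSemidef_sum _ fun k _ => ?_
  refine Matrix.PosSemidef.smul ?_ (ht k)
  simpa using Matrix.posSemidef_self_mul_conjTranspose (shiftMatrix m (fun l => (c k l : ℝ)))

/-- The point is that the bound does not depend on `n`. -/
theorem trace_gramMatrix_onesSeq_block {κ : Type*} [Fintype κ] {t : κ → ℝ} (ht : ∀ k, 0 ≤ t k)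
    (N : κ → ℕ) (n d : ℕ) [NeZero (n + d)] :
    ((gramMatrix t (fun k => onesSeq (N k)) (n + d)).submatrix
      finSumFinEquiv finSumFinEquiv).toBlocks₂₂.trace ≤ d * ∑ k, t k * N k := by
  have hdiag (i : Fin (n + d)) :
      gramMatrix t (fun k => onesSeq (N k)) (n + d) i i ≤ ∑ k, t k * N k := by
    simp only [gramMatrix, Matrix.sum_apply, Matrix.smul_apply, smul_eq_mul, Matrix.mul_apply,
      Matrix.transpose_apply, shiftMatrix, Matrix.of_apply]
    refine Finset.sum_le_sum fun k _ => mul_le_mul_of_nonneg_left ?_ (ht k)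
    rw [← Equiv.sum_comp (Equiv.addRight i)]
    simp only [Equiv.coe_addRight, add_sub_cancel_right, onesSeq]
    rw [← Finset.sum_range (fun x => (((if x < N k then 1 else 0 : ℤ)) : ℝ) *
      ((if x < N k then 1 else 0 : ℤ) : ℝ))]
    have : ∀ x ∈ Finset.range (n + d), (((if x < N k then 1 else 0 : ℤ)) : ℝ) *
      ((if x < N k then 1 else 0 : ℤ) : ℝ) = if x < N k then 1 else 0 := by
      intro x _
      split_ifs <;> simp
    rw [Finset.sum_congr rfl this, Finset.sum_boole]
    have h2 : (Finset.range (n + d)).filter (fun x => x < N k) ⊆ Finset.range (N k) := by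
      intro x
      simp
    have := Finset.card_le_card h2
    rw [Finset.card_range] at this
    exact_mod_cast this
  calc _ ≤ ∑ _i : Fin d, ∑ k, t k * N k := Finset.sum_le_sum fun i _ => hdiag _
    _ = _ := by simp

/-- Up to a factor independent of `n`, the determinants of the circulant Gram matrices are ordered
like those of their Toeplitz blocks. -/
theorem exists_det_gramMatrix_le {κ : Type*} [Fintype κ] {t : κ → ℝ} (ht : ∀ k, 0 < t k)
    {N : κ → ℕ} {c : κ → ℕ → ℤ} (hc : ∀ k l, (onesSeq (N k) l : ZMod 2) = c k l) {k₀ : κ}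
    (hN : N k₀ = 1) (hk₀ : c k₀ = onesSeq 1) {d : ℕ} (hd : ∀ k, N k ≤ d) (hd0 : 0 < d) :
    ∃ C : ℝ, 0 < C ∧ ∀ n : ℕ, (gramMatrix t (fun k => onesSeq (N k)) (n + d)).det ≤
      C * (gramMatrix t c (n + d)).det := by
  set T : ℝ := d * ∑ k, t k * N k
  have hT : 0 < T := by
    have h1 : 0 < ∑ k, t k * (N k : ℝ) := by
      refine Finset.sum_pos' (fun k _ => mul_nonneg (ht k).le (Nat.cast_nonneg _))
        ⟨k₀, Finset.mem_univ _, ?_⟩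
      simpa [hN] using ht k₀
    positivity
  -- `T ^ d` is the cost of enlarging the block for the ones sequences, `t k₀ ^ d` the least gain
  -- for `c`.
  refine ⟨T ^ d / t k₀ ^ d, by have := ht k₀; positivity, fun n => ?_⟩
  have : NeZero (n + d) := ⟨by omega⟩
  have ht' : ∀ k, 0 ≤ t k := fun k => (ht k).le
  have aux (b : κ → ℕ → ℤ) (hb : b k₀ = onesSeq 1) := by
    have h := (posSemidef_gramMatrix_sub ht' hb (n + d)).submatrix
      (finSumFinEquiv : Fin n ⊕ Fin d ≃ Fin (n + d))
    have e : ((gramMatrix t b (n + d) - t k₀ • (1 : Matrix (Fin (n + d)) (Fin (n + d)) ℝ)).submatrix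
        (finSumFinEquiv : Fin n ⊕ Fin d ≃ Fin (n + d)) finSumFinEquiv) =
        (gramMatrix t b (n + d)).submatrix finSumFinEquiv finSumFinEquiv -
          t k₀ • (1 : Matrix (Fin n ⊕ Fin d) (Fin n ⊕ Fin d) ℝ) := by
      rw [← Matrix.submatrix_one_equiv (finSumFinEquiv : Fin n ⊕ Fin d ≃ Fin (n + d))]
      rfl
    rw [e] at h
    have h2 := det_bounds_of_posSemidef_sub (ht k₀) h
    rw [Matrix.det_submatrix_equiv_self, Fintype.card_fin] at h2
    exact h2
  obtain ⟨hD1, -, hD⟩ := aux (fun k => onesSeq (N k)) (by simp [hN])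
  obtain ⟨-, hf, -⟩ := aux c hk₀
  have hblock := det_gramBlock_le ht' hc (n := n) hd
  have htr := trace_gramMatrix_onesSeq_block ht' N n d
  have htr0 : 0 ≤ ((gramMatrix t (fun k => onesSeq (N k)) (n + d)).submatrix
      (finSumFinEquiv : Fin n ⊕ Fin d ≃ Fin (n + d)) finSumFinEquiv).toBlocks₂₂.trace := by
    have hP : (gramMatrix t (fun k => onesSeq (N k)) (n + d)).PosSemidef := by
      simpa using (posSemidef_gramMatrix_sub ht' (c := fun k => onesSeq (N k)) (k₀ := k₀)
        (by simp [hN]) (n + d)).add (Matrix.PosSemidef.one.smul (ht k₀).le)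
    exact Finset.sum_nonneg fun i _ => hP.diag_nonneg
  have hε : 0 < t k₀ ^ d := pow_pos (ht k₀) d
  rw [div_mul_eq_mul_div, le_div_iff₀ hε]
  calc _ ≤ ((gramBlock t (fun k => onesSeq (N k)) n d).det * T ^ d) * t k₀ ^ d := by
        refine mul_le_mul_of_nonneg_right (hD.trans ?_) hε.le
        exact mul_le_mul_of_nonneg_left (pow_le_pow_left₀ htr0 htr _) hD1.le
    _ ≤ ((gramBlock t c n d).det * T ^ d) * t k₀ ^ d := by gcongr
    _ = T ^ d * ((gramBlock t c n d).det * t k₀ ^ d) := by ring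
    _ ≤ _ := mul_le_mul_of_nonneg_left hf (by positivity)

/-! ### Riemann sums and the strictly positive case -/

open Filter Topology in
theorem tendsto_riemannSum {g : ℝ → ℝ} (hg : Continuous g) {T : ℝ} (hT : 0 < T) :
    Tendsto (fun m : ℕ => T / m * ∑ l : Fin m, g (T * (l : ℕ) / m)) atTop
      (𝓝 (∫ x in (0 : ℝ)..T, g x)) := by
  rw [Metric.tendsto_atTop]
  intro ε hε
  have huc : UniformContinuousOn g (Set.Icc 0 T) :=
    isCompact_Icc.uniformContinuousOn_of_continuous hg.continuousOn
  rw [Metric.uniformContinuousOn_iff] at huc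
  obtain ⟨δ, hδ, h⟩ := huc (ε / (2 * T)) (by positivity)
  obtain ⟨M, hM⟩ := exists_nat_gt (T / δ)
  refine ⟨M + 1, fun m hm => ?_⟩
  have hm0 : (0 : ℝ) < m := by exact_mod_cast (by omega : 0 < m)
  have hMm : T / δ < m := hM.trans (by exact_mod_cast (by omega : M < m))
  have hmesh : T / m < δ := by
    rw [div_lt_iff₀ hδ] at hMm
    rw [div_lt_iff₀ hm0]
    linarith
  have hsplit := intervalIntegral.sum_integral_adjacent_intervals (f := g)
    (μ := MeasureTheory.volume) (a := fun l : ℕ => T * l / m) (n := m)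
    fun k _ => hg.intervalIntegrable _ _
  simp only [Nat.cast_zero, mul_zero, zero_div, mul_div_assoc, div_self hm0.ne', mul_one] at hsplit
  rw [← Finset.sum_range (fun l : ℕ => g (T * l / m)), ← hsplit, Finset.mul_sum, Real.dist_eq,
    ← Finset.sum_sub_distrib]
  have key : ∀ l ∈ Finset.range m, |T / m * g (T * l / m) -
      ∫ x in (T * ((l : ℝ) / m))..(T * (((l + 1 : ℕ) : ℝ) / m)), g x| ≤ ε / (2 * T) * (T / m) := by
    intro l hl
    have hl' : (l : ℝ) + 1 ≤ m := by exact_mod_cast Finset.mem_range.1 hl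
    have hlen : T * (((l + 1 : ℕ) : ℝ) / m) - T * ((l : ℝ) / m) = T / m := by
      push_cast
      field_simp
      ring
    have hle : T * ((l : ℝ) / m) ≤ T * (((l + 1 : ℕ) : ℝ) / m) := by
      have : 0 < T / m := by positivity
      linarith
    have hend : T * (((l + 1 : ℕ) : ℝ) / m) ≤ T := by
      rw [← mul_div_assoc, div_le_iff₀ hm0]
      push_cast
      gcongr
    have hstart : 0 ≤ T * ((l : ℝ) / m) := by positivity
    have hconst : T / m * g (T * l / m) =
        ∫ _x in (T * ((l : ℝ) / m))..(T * (((l + 1 : ℕ) : ℝ) / m)), g (T * l / m) := by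
      rw [intervalIntegral.integral_const, hlen, smul_eq_mul]
    rw [hconst, ← intervalIntegral.integral_sub (by simp) (hg.intervalIntegrable _ _),
      ← Real.norm_eq_abs]
    refine (intervalIntegral.norm_integral_le_of_norm_le_const (C := ε / (2 * T)) ?_).trans ?_
    · intro x hx
      rw [Set.uIoc_of_le hle] at hx
      have := h (T * ((l : ℝ) / m)) ⟨hstart, hle.trans hend⟩ x ⟨hstart.trans hx.1.le, hx.2.trans hend⟩
        (by rw [Real.dist_eq, abs_sub_comm, abs_of_pos (by linarith [hx.1])]; linarith [hx.2])
      rw [Real.dist_eq, ← mul_div_assoc] at this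
      exact this.le
    · rw [hlen, abs_of_pos (by positivity)]
  calc _ ≤ ∑ l ∈ Finset.range m, ε / (2 * T) * (T / m) :=
        (Finset.abs_sum_le_sum_abs _ _).trans (Finset.sum_le_sum key)
    _ = ε / 2 := by
        rw [Finset.sum_const, Finset.card_range, nsmul_eq_mul]
        field_simp
    _ < ε := by linarith

theorem continuous_sqSum {κ : Type*} [Fintype κ] (t : κ → ℝ) (N : κ → ℕ) (c : κ → ℕ → ℤ) :
    Continuous (sqSum t N c) := by
  unfold sqSum trigSum
  fun_prop

theorem sqSum_pos {κ : Type*} [Fintype κ] {t : κ → ℝ} (ht : ∀ k, 0 < t k) {N : κ → ℕ}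
    {c : κ → ℕ → ℤ} {k₀ : κ} (hN : N k₀ = 1) (hk₀ : c k₀ = onesSeq 1) (θ : ℝ) :
    0 < sqSum t N c θ := by
  refine Finset.sum_pos' (fun k _ => mul_nonneg (ht k).le (sq_nonneg _))
    ⟨k₀, Finset.mem_univ _, ?_⟩
  simpa [hN, hk₀, trigSum, onesSeq] using ht k₀

open Filter Topology in
theorem integral_log_sqSum_le {κ : Type*} [Fintype κ] {t : κ → ℝ} (ht : ∀ k, 0 < t k)
    {N : κ → ℕ} {c : κ → ℕ → ℤ} (hc : ∀ k l, (onesSeq (N k) l : ZMod 2) = c k l)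
    (hc0 : ∀ k l, N k ≤ l → c k l = 0) {k₀ : κ} (hN : N k₀ = 1) (hk₀ : c k₀ = onesSeq 1) :
    ∫ θ in (0 : ℝ)..(2 * Real.pi), Real.log (sqSum t N (fun k => onesSeq (N k)) θ) ≤
      ∫ θ in (0 : ℝ)..(2 * Real.pi), Real.log (sqSum t N c θ) := by
  set d := ∑ k, N k
  have hd : ∀ k, N k ≤ d := fun k => Finset.single_le_sum (fun _ _ => Nat.zero_le _)
    (Finset.mem_univ k)
  have hd0 : 0 < d := by have := hd k₀; omega
  obtain ⟨C, hC, hdet⟩ := exists_det_gramMatrix_le ht hc hN hk₀ hd hd0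
  have hposD : ∀ θ, 0 < sqSum t N (fun k => onesSeq (N k)) θ := sqSum_pos ht hN (by simp [hN])
  have hposc : ∀ θ, 0 < sqSum t N c θ := sqSum_pos ht hN hk₀
  have hsum (n : ℕ) :
      ∑ l : Fin (n + d), Real.log (sqSum t N (fun k => onesSeq (N k))
        (2 * Real.pi * (l : ℕ) / (n + d : ℕ))) ≤
      Real.log C + ∑ l : Fin (n + d), Real.log (sqSum t N c
        (2 * Real.pi * (l : ℕ) / (n + d : ℕ))) := by
    have : NeZero (n + d) := ⟨by omega⟩
    have hm : ∀ k, N k ≤ n + d := fun k => (hd k).trans (Nat.le_add_left _ _)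
    have h := hdet n
    rw [det_gramMatrix t (N := N) (fun k l hl => by simp [onesSeq, hl]) hm,
      det_gramMatrix t hc0 hm] at h
    have hp1 : 0 < ∏ l : Fin (n + d), sqSum t N (fun k => onesSeq (N k))
      (2 * Real.pi * (l : ℕ) / (n + d : ℕ)) := Finset.prod_pos fun l _ => hposD _
    have hp2 : 0 < ∏ l : Fin (n + d), sqSum t N c
      (2 * Real.pi * (l : ℕ) / (n + d : ℕ)) := Finset.prod_pos fun l _ => hposc _
    have h' := Real.log_le_log hp1 h
    rwa [Real.log_mul hC.ne' hp2.ne', Real.log_prod fun l _ => (hposD _).ne',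
      Real.log_prod fun l _ => (hposc _).ne'] at h'
  have hlim (b : κ → ℕ → ℤ) (hb : ∀ θ, 0 < sqSum t N b θ) :=
    (tendsto_riemannSum ((continuous_sqSum t N b).log fun θ => (hb θ).ne')
      Real.two_pi_pos).comp (tendsto_add_atTop_nat d)
  -- The determinant comparison loses only `log C`, which the mesh factor sends to 0.
  have hlim0 : Tendsto (fun n : ℕ => 2 * Real.pi / ((n + d : ℕ) : ℝ) * Real.log C) atTop (𝓝 0) := by
    have := (tendsto_const_div_atTop_nhds_zero_nat (2 * Real.pi)).comp (tendsto_add_atTop_nat d)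
    simpa using this.mul_const (Real.log C)
  refine le_of_tendsto_of_tendsto' (hlim _ hposD)
    (by simpa only [zero_add] using hlim0.add (hlim _ hposc)) fun n => ?_
  simp only [Function.comp_apply]
  rw [← mul_add]
  exact mul_le_mul_of_nonneg_left (hsum n) (by positivity)

/-! ### Integrability of the logarithms -/

-- `log g` lies between `log h` and `g - 1`, both integrable.
open MeasureTheory in
theorem intervalIntegrable_log_of_le {g h : ℝ → ℝ} {a b : ℝ} (hg : Continuous g)
    (hh : IntervalIntegrable (fun x => Real.log (h x)) volume a b) (hpos : ∀ x, 0 ≤ h x)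
    (hle : ∀ x, h x ≤ g x) (hne : ∀ᵐ x, h x ≠ 0) :
    IntervalIntegrable (fun x => Real.log (g x)) volume a b := by
  have hb : IntervalIntegrable (fun x => |Real.log (h x)| + |g x|) volume a b :=
    hh.abs.add (hg.abs.intervalIntegrable _ _)
  refine hb.mono_fun' (Real.measurable_log.comp hg.measurable).aestronglyMeasurable ?_
  filter_upwards [ae_restrict_of_ae hne] with x hx
  have hx0 : 0 < h x := lt_of_le_of_ne (hpos x) (Ne.symm hx)
  have h1 := Real.log_le_log hx0 (hle x)
  have h2 := Real.log_le_sub_one_of_pos (hx0.trans_le (hle x))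
  rw [Real.norm_eq_abs, abs_le]
  have h3 := neg_abs_le (Real.log (h x))
  have h4 := abs_nonneg (g x)
  have h5 := le_abs_self (g x)
  have h6 := abs_nonneg (Real.log (h x))
  constructor <;> linarith

theorem analyticAt_eval_exp (p : ℂ[X]) (θ : ℝ) :
    AnalyticAt ℝ (fun θ : ℝ => p.eval (Complex.exp (Complex.I * (θ : ℂ)))) θ := by
  have h1 : AnalyticAt ℝ (fun z : ℂ => p.eval (Complex.exp (Complex.I * z))) (θ : ℂ) := by
    have h : AnalyticAt ℂ (fun z : ℂ => p.eval (Complex.exp (Complex.I * z))) (θ : ℂ) := by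
      refine Differentiable.analyticAt ?_ _
      exact p.differentiable.comp (by fun_prop)
    exact h.restrictScalars
  exact h1.comp (Complex.ofRealCLM.analyticAt θ)

open MeasureTheory in
theorem ae_eval_exp_ne_zero {p : ℂ[X]} (hp : p ≠ 0) :
    ∀ᵐ θ : ℝ, p.eval (Complex.exp (Complex.I * (θ : ℂ))) ≠ 0 := by
  have hfin : (p.roots.toFinset : Set ℂ).Countable := p.roots.toFinset.countable_toSet
  have hc : {θ : ℝ | p.eval (Complex.exp (Complex.I * (θ : ℂ))) = 0}.Countable := by
    have : {θ : ℝ | p.eval (Complex.exp (Complex.I * (θ : ℂ))) = 0} ⊆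
        (fun θ : ℝ => Complex.I * (θ : ℂ)) ⁻¹'
          (Complex.exp ⁻¹' (p.roots.toFinset : Set ℂ)) := by
      intro θ hθ
      simpa [hp] using hθ
    refine Set.Countable.mono this (Set.Countable.preimage_of_injOn ?_ ?_)
    · exact hfin.preimage_cexp
    · intro x _ y _ h
      simpa using h
  rw [ae_iff]
  simpa using hc.measure_zero volume

-- One term of the sum suffices as a minorant: the log-norm of an analytic function is integrable
-- despite its zeros.
open MeasureTheory in
theorem intervalIntegrable_log_sum {κ : Type*} [Fintype κ] [Nonempty κ] {t : κ → ℝ}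
    (ht : ∀ k, 0 < t k) {f : κ → ℂ[X]} (hf : ∀ k, f k ≠ 0) :
    IntervalIntegrable (fun θ : ℝ => Real.log (∑ k,
      t k * ‖(f k).eval (Complex.exp (Complex.I * (θ : ℂ)))‖ ^ 2)) volume 0 (2 * Real.pi) := by
  obtain ⟨k⟩ := ‹Nonempty κ›
  refine intervalIntegrable_log_of_le
    (h := fun θ => t k * ‖(f k).eval (Complex.exp (Complex.I * (θ : ℂ)))‖ ^ 2)
    (by fun_prop) ?_ (fun x => by have := ht k; positivity) ?_ ?_
  · have h1 : IntervalIntegrable (fun θ : ℝ =>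
        Real.log ‖(f k).eval (Complex.exp (Complex.I * (θ : ℂ)))‖) volume 0 (2 * Real.pi) :=
      MeromorphicOn.intervalIntegrable_log_norm fun θ _ =>
        (analyticAt_eval_exp (f k) θ).meromorphicAt
    have h2 : IntervalIntegrable (fun θ : ℝ => Real.log (t k) + 2 *
        Real.log ‖(f k).eval (Complex.exp (Complex.I * (θ : ℂ)))‖) volume 0 (2 * Real.pi) :=
      (by simp : IntervalIntegrable (fun _ : ℝ => Real.log (t k)) volume 0 (2 * Real.pi)).add
        (h1.const_mul 2)
    refine h2.congr_ae ?_
    filter_upwards [ae_restrict_of_ae (ae_eval_exp_ne_zero (hf k))] with θ hθ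
    have := norm_pos_iff.2 hθ
    rw [Real.log_mul (ht k).ne' (by positivity), Real.log_pow]
    norm_num
  · intro θ
    exact Finset.single_le_sum (f := fun k =>
      t k * ‖(f k).eval (Complex.exp (Complex.I * (θ : ℂ)))‖ ^ 2)
      (fun k _ => mul_nonneg (ht k).le (sq_nonneg _)) (Finset.mem_univ k)
  · filter_upwards [ae_eval_exp_ne_zero (hf k)] with θ hθ
    have := norm_pos_iff.2 hθ
    have := ht k
    positivity

/-! ### Removing the regularisation -/

open MeasureTheory Filter Topology in
theorem le_integral_log_of_forall_add {g : ℝ → ℝ} (hg : Continuous g) (hg0 : ∀ x, 0 ≤ g x)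
    (hne : ∀ᵐ x, g x ≠ 0) {a b L : ℝ}
    (hint : IntervalIntegrable (fun x => Real.log (g x)) volume a b)
    (h : ∀ ε : ℝ, 0 < ε → L ≤ ∫ x in a..b, Real.log (ε + g x)) :
    L ≤ ∫ x in a..b, Real.log (g x) := by
  have hlim : Tendsto (fun ε : ℝ => ∫ x in a..b, Real.log (ε + g x)) (𝓝[>] 0)
      (𝓝 (∫ x in a..b, Real.log (g x))) := by
    refine intervalIntegral.tendsto_integral_filter_of_dominated_convergence
      (fun x => |Real.log (g x)| + |g x|) ?_ ?_ (hint.abs.add (hg.abs.intervalIntegrable _ _)) ?_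
    · refine Eventually.of_forall fun ε => ?_
      exact (Real.measurable_log.comp (continuous_const.add hg).measurable).aestronglyMeasurable
    -- For `ε ≤ 1`, `log g ≤ log (ε + g) ≤ ε + g - 1 ≤ g`, so the dominating function is free of
    -- `ε`.
    · have h1 : ∀ᶠ ε : ℝ in 𝓝[>] 0, ε ∈ Set.Ioc (0 : ℝ) 1 := Ioc_mem_nhdsGT one_pos
      filter_upwards [h1] with ε hε
      filter_upwards [hne] with x hx _
      have hx0 : 0 < g x := lt_of_le_of_ne (hg0 x) (Ne.symm hx)
      have h1 := Real.log_le_log hx0 (show g x ≤ ε + g x by linarith [hε.1])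
      have h2 := Real.log_le_sub_one_of_pos (show 0 < ε + g x by linarith [hε.1])
      rw [Real.norm_eq_abs, abs_le]
      have h3 := neg_abs_le (Real.log (g x))
      have h4 := abs_nonneg (g x)
      have h5 := le_abs_self (g x)
      have h6 := abs_nonneg (Real.log (g x))
      constructor <;> linarith [hε.2]
    · filter_upwards [hne] with x hx _
      have h1 : Tendsto (fun ε : ℝ => ε + g x) (𝓝[>] 0) (𝓝 (g x)) := by
        have : Tendsto (fun ε : ℝ => ε + g x) (𝓝 0) (𝓝 (0 + g x)) :=
          (continuous_id.add continuous_const).tendsto 0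
        rw [zero_add] at this
        exact this.mono_left nhdsWithin_le_nhds
      exact h1.log hx
  refine ge_of_tendsto hlim ?_
  filter_upwards [self_mem_nhdsWithin] with ε hε
  exact h ε hε

/-! ### Littlewood polynomials and the conclusion -/

theorem littlewoodPoly_ne_zero {N : ℕ} (hN : 1 ≤ N) {f : ℂ[X]} (hf : f ∈ LittlewoodPoly N) :
    f ≠ 0 := by
  obtain ⟨c, hc, rfl⟩ := hf
  intro h
  have h0 := congrArg (fun p => p.coeff 0) h
  have h1 : c 0 = 0 := by
    simpa [Polynomial.finsetSum_coeff, Polynomial.coeff_X_pow, eq_comm,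
      show 0 < N from hN] using h0
  rcases hc 0 hN with h2 | h2 <;> simp [h2] at h1

/-- A Littlewood polynomial has an integer coefficient sequence with the same parities as that of
`dirichletPoly`. -/
theorem exists_intSeq_of_mem_littlewoodPoly {N : ℕ} {f : ℂ[X]} (hf : f ∈ LittlewoodPoly N) :
    ∃ c : ℕ → ℤ, (∀ l, (onesSeq N l : ZMod 2) = c l) ∧ (∀ l, N ≤ l → c l = 0) ∧
      ∀ θ : ℝ, f.eval (Complex.exp (Complex.I * (θ : ℂ))) = trigSum N c θ := by
  classical
  obtain ⟨c, hc, rfl⟩ := hf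
  refine ⟨fun l => if l < N then (if c l = 1 then 1 else -1) else 0, ?_, ?_, ?_⟩
  · intro l
    simp only [onesSeq]
    split_ifs <;> rfl
  · intro l hl
    simp [hl]
  · intro θ
    rw [trigSum, Polynomial.eval_finsetSum]
    refine Finset.sum_congr rfl fun l hl => ?_
    have hl' := Finset.mem_range.1 hl
    rcases hc l hl' with h | h
    · simp [hl', h]
    · simp only [hl', h]
      norm_num

theorem eval_dirichletPoly (N : ℕ) (θ : ℝ) :
    (dirichletPoly N).eval (Complex.exp (Complex.I * (θ : ℂ))) = trigSum N (onesSeq N) θ := by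
  rw [dirichletPoly, trigSum, Polynomial.eval_finsetSum]
  refine Finset.sum_congr rfl fun l hl => ?_
  simp [onesSeq, Finset.mem_range.1 hl]

theorem theorem1p1 (K : ℕ) (hK : 1 ≤ K) (N : Fin K → ℕ) (hN : ∀ k, 1 ≤ N k)
    (f : Fin K → Polynomial ℂ) (hf : ∀ k, f k ∈ LittlewoodPoly (N k))
    (t : Fin K → ℝ) (ht : ∀ k, 0 < t k) :
    IntervalIntegrable (fun θ : ℝ => Real.log (∑ k,
        t k * ‖(dirichletPoly (N k)).eval (Complex.exp (Complex.I * (θ : ℂ)))‖ ^ 2))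
      MeasureTheory.volume 0 (2 * Real.pi) ∧
    IntervalIntegrable (fun θ : ℝ => Real.log (∑ k,
        t k * ‖(f k).eval (Complex.exp (Complex.I * (θ : ℂ)))‖ ^ 2))
      MeasureTheory.volume 0 (2 * Real.pi) ∧
    ∫ θ in (0 : ℝ)..(2 * Real.pi), Real.log (∑ k,
        t k * ‖(dirichletPoly (N k)).eval (Complex.exp (Complex.I * (θ : ℂ)))‖ ^ 2) ≤
      ∫ θ in (0 : ℝ)..(2 * Real.pi), Real.log (∑ k,
        t k * ‖(f k).eval (Complex.exp (Complex.I * (θ : ℂ)))‖ ^ 2) := by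
  have : Nonempty (Fin K) := ⟨⟨0, hK⟩⟩
  have hD0 (k) : dirichletPoly (N k) ≠ 0 := littlewoodPoly_ne_zero (hN k) (dirichletPoly_mem _)
  have hf0 (k) : f k ≠ 0 := littlewoodPoly_ne_zero (hN k) (hf k)
  have hsum_ne {F : Fin K → ℂ[X]} (hF : ∀ k, F k ≠ 0) : ∀ᵐ θ : ℝ, 0 < ∑ k,
      t k * ‖(F k).eval (Complex.exp (Complex.I * (θ : ℂ)))‖ ^ 2 := by
    filter_upwards [ae_eval_exp_ne_zero (hF ⟨0, hK⟩)] with θ hθ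
    refine Finset.sum_pos' (fun k _ => mul_nonneg (ht k).le (sq_nonneg _))
      ⟨_, Finset.mem_univ ⟨0, hK⟩, mul_pos (ht _) (pow_pos (norm_pos_iff.2 hθ) 2)⟩
  have hID := intervalIntegrable_log_sum ht hD0
  refine ⟨hID, intervalIntegrable_log_sum ht hf0, ?_⟩
  refine le_integral_log_of_forall_add (by fun_prop)
    (fun θ => Finset.sum_nonneg fun k _ => mul_nonneg (ht k).le (sq_nonneg _))
    ((hsum_ne hf0).mono fun θ hθ => hθ.ne') (intervalIntegrable_log_sum ht hf0) fun ε hε => ?_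
  choose c hc hc0 heval using fun k => exists_intSeq_of_mem_littlewoodPoly (hf k)
  -- The index `none` carries the extra term: weight `ε` on the polynomial `1`.
  let t' : Option (Fin K) → ℝ := fun o => o.elim ε t
  let N' : Option (Fin K) → ℕ := fun o => o.elim 1 N
  let c' : Option (Fin K) → ℕ → ℤ := fun o => o.elim (onesSeq 1) c
  have ht' : ∀ o, 0 < t' o := by rintro (_ | k); exacts [hε, ht k]
  have hone (θ : ℝ) : trigSum 1 (onesSeq 1) θ = 1 := by simp [trigSum, onesSeq]
  have key := integral_log_sqSum_le (t := t') (N := N') (c := c') (k₀ := none) ht'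
    (by rintro (_ | k) l; exacts [rfl, hc k l])
    (by rintro (_ | k) l hl; exacts [if_neg (not_lt.2 hl), hc0 k l hl]) rfl rfl
  have eD (θ : ℝ) : sqSum t' N' (fun k => onesSeq (N' k)) θ = ε + ∑ k,
      t k * ‖(dirichletPoly (N k)).eval (Complex.exp (Complex.I * (θ : ℂ)))‖ ^ 2 := by
    simp [sqSum, Fintype.sum_option, t', N', hone, eval_dirichletPoly]
  have ef (θ : ℝ) : sqSum t' N' c' θ = ε + ∑ k,
      t k * ‖(f k).eval (Complex.exp (Complex.I * (θ : ℂ)))‖ ^ 2 := by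
    simp [sqSum, Fintype.sum_option, t', N', c', hone, heval]
  simp only [eD, ef] at key
  -- On the Dirichlet side `ε` is dropped by monotonicity of the logarithm; only the side of `f`
  -- needs the limit.
  refine le_trans ?_ key
  refine intervalIntegral.integral_mono_ae Real.two_pi_pos.le hID ?_ ?_
  · refine Continuous.intervalIntegrable ?_ _ _
    refine Continuous.log (by fun_prop) fun θ => ?_
    have : 0 ≤ ∑ k, t k * ‖(dirichletPoly (N k)).eval (Complex.exp (Complex.I * (θ : ℂ)))‖ ^ 2 :=
      Finset.sum_nonneg fun k _ => mul_nonneg (ht k).le (sq_nonneg _)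
    positivity
  · filter_upwards [hsum_ne hD0] with θ hθ
    exact Real.log_le_log hθ (by linarith)
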